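/- Let $\Gamma$ be a countable group with a proper left-invariant distance $d$ (every ball is finite), and write $|g|=d(g,e)$. Let $\mu$ be a symmetric probability measure on $\Gamma$ (that is, $\mu(g^{-1})=\mu(g)$ for all $g$) with finite first moment $\sum_g |g|\,\mu(g)<\infty$. Let $\mu^{*n}$ be the $n$-fold convolution of $\mu$, and for $p\ge 1$ put $M_p(\mu)=\bigl(\sum_g |g|^p\mu(g)\bigr)^{1/p}\in[0,\infty]$. Then the drift and the asymptotic entropy $$\ell=\lim_{n\to\infty}\frac1n\sum_g |g|\,\mu^{*n}(g)\in[0,\infty),\qquad h=\lim_{n\to\infty}-\frac1n\sum_g \mu^{*n}(g)\log\mu^{*n}(g)\in[0,\infty]$$ exist, and $$\sum_{n=1}^{\infty}\frac{2}{2n-1}\left(\frac{\ell}{M_{1+1/(2n-1)}(\mu)}\right)^{2n}\le h ,$$ where a term whose moment $M_{1+1/(2n-1)}(\mu)$ is infinite is read as $0$, and $0/0$ is read as $0$ (this occurs only for $\mu=\delta_e$). This strengthens the inequality $2\tilde\ell\,\operatorname{artanh}\tilde\ell\le h$, where $\tilde\ell=\ell/M_2(\mu)$: if $M_2(\mu)<\infty$,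 then $\tilde\ell<1$ and $$2\tilde\ell\,\operatorname{artanh}\tilde\ell\le\sum_{n=1}^{\infty}\frac{2}{2n-1}\left(\frac{\ell}{M_{1+1/(2n-1)}(\mu)}\right)^{2n}.$$ -/

import Mathlib

open Filter Topology
open scoped ENNReal

namespace GroupWalk

noncomputable section

/-- The `n`-fold convolution `μ^{*n}`: the law of `X_n = γ₁ ⋯ γ_n` for independent
`μ`-distributed `γ_i`, with `X_0` the identity. -/
def convPow {Γ : Type*} [Group Γ] (μ : PMF Γ) : ℕ → PMF Γ
  | 0 => PMF.pure 1
  | n + 1 => (convPow μ n).bind fun x => μ.map fun y => x * y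

/-- The Shannon entropy `-∑ ν(g) log ν(g)`, a sum of nonnegative terms, with value in `[0, ∞]`. -/
def entropy {Γ : Type*} (ν : PMF Γ) : ℝ≥0∞ :=
  ∑' g, ENNReal.ofReal (Real.negMulLog (ν g).toReal)

/-- The mean distance to the identity `∑ |g| ν(g)`, with value in `[0, ∞]`. -/
def meanLength {Γ : Type*} [Group Γ] [MetricSpace Γ] (ν : PMF Γ) : ℝ≥0∞ :=
  ∑' g, ENNReal.ofReal (dist g 1) * ν g

/-- `M_p(ν) = (∑ |g|^p ν(g))^{1/p}`, with value in `[0, ∞]`. -/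
def pMoment {Γ : Type*} [Group Γ] [MetricSpace Γ] (p : ℝ) (ν : PMF Γ) : ℝ≥0∞ :=
  (∑' g, ENNReal.ofReal (dist g 1 ^ p) * ν g) ^ (1 / p)

/-- The asymptotic entropy `h = lim H(μ^{*n}) / n`. -/
def asympEntropy {Γ : Type*} [Group Γ] (μ : PMF Γ) : ℝ≥0∞ :=
  limUnder atTop fun n : ℕ => entropy (convPow μ n) / (n : ℝ≥0∞)

/-- The drift `ℓ = lim (1/n) ∑ |g| μ^{*n}(g)`. -/
def drift {Γ : Type*} [Group Γ] [MetricSpace Γ] (μ : PMF Γ) : ℝ≥0∞ :=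
  limUnder atTop fun n : ℕ => meanLength (convPow μ n) / (n : ℝ≥0∞)

/-- The sum over `n ≥ 1` of `2 / (2n-1) * (ℓ / M_{1+1/(2n-1)}(μ))^{2n}`. In `[0, ∞]` the quotient
by an infinite moment is `0`, and so is `0 / 0`. -/
def driftSeries {Γ : Type*} [Group Γ] [MetricSpace Γ] (μ : PMF Γ) : ℝ≥0∞ :=
  ∑' n : ℕ+, ENNReal.ofReal (2 / (2 * (n : ℝ) - 1)) *
    (drift μ / pMoment (1 + 1 / (2 * (n : ℝ) - 1)) μ) ^ (2 * (n : ℕ))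

end

end GroupWalk

/-!
Kill the walk before each step with probability `p`, let `G` be the law of its endpoint, and let
`R x y = |G x - G y| / (G x + G y)` on the edges `(x, x g)`, weighted by `μ g`. Since
`(a - b) (log a - log b) = (a + b) · 2 r artanh r` for `r = (a - b) / (a + b)`, the entropy
production of `G` under one more step dominates the `G`-mean of
`2 R artanh R = ∑ 2 / (2 n - 1) R ^ (2 n)`. The pointwise bound `(1 - p) (G * μ) ≤ G` turns this
production into at most `p H(G)`, up to a factor tending to `1`, while the growth of the length in
one step, which is at least `ℓ`, is at most the `G`-mean of `R |g|`. Hölder's inequality with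
exponents `2 n` and `1 + 1 / (2 n - 1)` then bounds `(ℓ / M_{1 + 1/(2n-1)}(μ)) ^ (2 n)` by the mean
of `R ^ (2 n)`, term by term. Finally `limsup p H(G) ≤ h` as `p → 0` when `h` is finite, because `G`
is a mixture of the `μ^{*n}` over a geometric time of mean `(1 - p) / p`, and the entropy of that
time is of smaller order than `1 / p`.
-/

namespace GroupWalk

section Sums

variable {α β : Type*}

lemma tsum_bind_mul (P : PMF α) (Q : α → PMF β) (f : β → ℝ≥0∞) :
    ∑' z, P.bind Q z * f z = ∑' x, P x * ∑' z, Q x z * f z := by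
  simp only [PMF.bind_apply, ← ENNReal.tsum_mul_right, ← ENNReal.tsum_mul_left]
  rw [ENNReal.tsum_comm]
  simp only [mul_assoc]

lemma tsum_map_mul (P : PMF α) (φ : α → β) (f : β → ℝ≥0∞) :
    ∑' z, P.map φ z * f z = ∑' x, P x * f (φ x) := by
  classical
  simp only [PMF.map, tsum_bind_mul, Function.comp_apply, PMF.pure_apply, ite_mul, one_mul,
    zero_mul, tsum_ite_eq]

lemma mul_apply_le_bind_apply (P : PMF α) (Q : α → PMF β) (x : α) (z : β) :
    P x * Q x z ≤ P.bind Q z :=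
  ENNReal.le_tsum (f := fun x => P x * Q x z) x

lemma apply_le_map_apply (P : PMF α) (φ : α → β) (x : α) : P x ≤ P.map φ (φ x) := by
  simpa using mul_apply_le_bind_apply P (PMF.pure ∘ φ) x (φ x)

lemma tsum_mul_mul_le_rpow_mul_rpow {p q : ℝ} (hpq : p.HolderConjugate q) (w f g : α → ℝ≥0∞) :
    ∑' i, w i * (f i * g i) ≤
      (∑' i, w i * f i ^ p) ^ (1 / p) * (∑' i, w i * g i ^ q) ^ (1 / q) := by
  have rpow_scale {r : ℝ} (hr : 0 < r) (a b : ℝ≥0∞) : (a ^ (1 / r) * b) ^ r = a * b ^ r := by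
    rw [ENNReal.mul_rpow_of_nonneg _ _ hr.le, ← ENNReal.rpow_mul, one_div_mul_cancel hr.ne',
      ENNReal.rpow_one]
  have split_weight (i : α) : w i * (f i * g i) = w i ^ (1 / p) * f i * (w i ^ (1 / q) * g i) := by
    rw [mul_mul_mul_comm, ← ENNReal.rpow_add_of_nonneg _ _ hpq.one_div_nonneg
      hpq.symm.one_div_nonneg, one_div, one_div, hpq.inv_add_inv_eq_one, ENNReal.rpow_one]
  rw [ENNReal.tsum_eq_iSup_sum]
  refine iSup_le fun s => ?_
  simp only [split_weight]
  refine (ENNReal.inner_le_Lp_mul_Lq s _ _ hpq).trans ?_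
  simp only [rpow_scale hpq.pos, rpow_scale hpq.symm.pos]
  have := hpq.one_div_nonneg
  have := hpq.symm.one_div_nonneg
  gcongr <;> exact ENNReal.sum_le_tsum s

lemma rpow_mean_mono {p q : ℝ} (hp : 0 < p) (hpq : p ≤ q) (P : PMF α) (f : α → ℝ≥0∞) :
    (∑' i, P i * f i ^ p) ^ (1 / p) ≤ (∑' i, P i * f i ^ q) ^ (1 / q) := by
  have hq : 0 < q := hp.trans_le hpq
  have hexp : 0 ≤ 1 - (q / p)⁻¹ := by
    rw [inv_div, sub_nonneg, div_le_one hq]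
    exact hpq
  have hmean : ∑' i, P i * f i ^ p ≤ (∑' i, P i * f i ^ q) ^ (q / p)⁻¹ := by
    rw [ENNReal.tsum_eq_iSup_sum]
    refine iSup_le fun s => ?_
    calc ∑ i ∈ s, P i * f i ^ p
        ≤ (∑ i ∈ s, P i) ^ (1 - (q / p)⁻¹) * (∑ i ∈ s, P i * (f i ^ p) ^ (q / p)) ^ (q / p)⁻¹ :=
          ENNReal.inner_le_weight_mul_Lp_of_nonneg s ((one_le_div hp).2 hpq) _ _
      _ ≤ 1 ^ (1 - (q / p)⁻¹) * (∑' i, P i * f i ^ q) ^ (q / p)⁻¹ := by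
          simp only [← ENNReal.rpow_mul, mul_div_cancel₀ q hp.ne']
          gcongr
          · exact (ENNReal.sum_le_tsum s).trans_eq P.tsum_coe
          · exact ENNReal.sum_le_tsum s
      _ = _ := by rw [ENNReal.one_rpow, one_mul]
  calc (∑' i, P i * f i ^ p) ^ (1 / p)
      ≤ ((∑' i, P i * f i ^ q) ^ (q / p)⁻¹) ^ (1 / p) := by gcongr
    _ = (∑' i, P i * f i ^ q) ^ (1 / q) := by
        rw [← ENNReal.rpow_mul]
        congr 1
        field_simp

end Sums

section Sequences

variable {u : ℕ → ℝ≥0∞}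

lemma le_nat_mul_of_subadditive (h0 : u 0 = 0) (hadd : ∀ m n, u (m + n) ≤ u m + u n) (n : ℕ) :
    u n ≤ n * u 1 := by
  induction n with
  | zero => simp [h0]
  | succ n ih =>
    rw [Nat.cast_succ, add_one_mul]
    exact (hadd n 1).trans (by gcongr)

lemma exists_tendsto_div_of_subadditive (hadd : ∀ m n, u (m + n) ≤ u m + u n)
    (hfin : ∀ n, u n ≠ ∞) : ∃ l : ℝ≥0∞, l ≠ ∞ ∧
      Tendsto (fun n : ℕ => u n / (n : ℝ≥0∞)) atTop (𝓝 l) ∧ ∀ n : ℕ, n * l ≤ u n := by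
  have hsub : Subadditive fun n => (u n).toReal := fun m n => by
    rw [← ENNReal.toReal_add (hfin m) (hfin n)]
    exact ENNReal.toReal_mono (ENNReal.add_ne_top.2 ⟨hfin m, hfin n⟩) (hadd m n)
  have hbdd : BddBelow (Set.range fun n : ℕ => (u n).toReal / n) :=
    ⟨0, by rintro _ ⟨n, rfl⟩; positivity⟩
  refine ⟨ENNReal.ofReal hsub.lim, ENNReal.ofReal_ne_top, ?_, fun n => ?_⟩
  · refine (ENNReal.tendsto_ofReal (hsub.tendsto_lim hbdd)).congr' ?_
    filter_upwards [eventually_gt_atTop 0] with n hn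
    rw [ENNReal.ofReal_div_of_pos (by positivity), ENNReal.ofReal_toReal (hfin n),
      ENNReal.ofReal_natCast]
  · rcases Nat.eq_zero_or_pos n with rfl | hn
    · simp
    have hlim : n * hsub.lim ≤ (u n).toReal := by
      have := hsub.lim_le_div hbdd hn.ne'
      rwa [le_div_iff₀ (by positivity), mul_comm] at this
    calc (n : ℝ≥0∞) * ENNReal.ofReal hsub.lim = ENNReal.ofReal (n * hsub.lim) := by
          rw [ENNReal.ofReal_mul n.cast_nonneg, ENNReal.ofReal_natCast]
      _ ≤ u n := ENNReal.ofReal_le_of_le_toReal hlim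

lemma exists_le_nat_mul_add_of_tendsto_div {l K : ℝ≥0∞} (hfin : ∀ n, u n ≠ ∞)
    (hu : Tendsto (fun n : ℕ => u n / (n : ℝ≥0∞)) atTop (𝓝 l)) (hK : l < K) :
    ∃ C : ℝ≥0∞, C ≠ ∞ ∧ ∀ n : ℕ, u n ≤ n * K + C := by
  obtain ⟨N, hN⟩ := eventually_atTop.1 (hu.eventually_lt_const hK)
  refine ⟨∑ n ∈ Finset.range (N + 1), u n, ENNReal.sum_ne_top.2 fun n _ => hfin n, fun n => ?_⟩
  rcases le_or_gt n N with hn | hn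
  · exact le_add_left (Finset.single_le_sum (fun _ _ => zero_le)
      (Finset.mem_range.2 (Nat.lt_succ_of_le hn)))
  · have hn0 : (n : ℝ≥0∞) ≠ 0 := by exact_mod_cast (Nat.zero_lt_of_lt hn).ne'
    have := (ENNReal.div_le_iff' hn0 (ENNReal.natCast_ne_top n)).1 (hN n hn.le).le
    exact this.trans le_self_add

end Sequences

section Entropy

/-- The information content `-log p` of an event of probability `p`, in `[0, ∞]`, truncated to `0`
for `p > 1`. It is `∞` at `p = 0`, so that cross entropies between laws with different supports
have the right value. -/
noncomputable def surprisal (p : ℝ≥0∞) : ℝ≥0∞ := (-ENNReal.log p).toENNReal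

lemma surprisal_zero : surprisal 0 = ∞ := by simp [surprisal]

lemma surprisal_one : surprisal 1 = 0 := by simp [surprisal]

lemma surprisal_ofReal {a : ℝ} (ha : 0 < a) :
    surprisal (ENNReal.ofReal a) = ENNReal.ofReal (-Real.log a) := by
  rw [surprisal, ENNReal.log_ofReal_of_pos ha, ← EReal.coe_neg, EReal.real_coe_toENNReal]

lemma antitone_surprisal : Antitone surprisal := fun _ _ h =>
  EReal.toENNReal_le_toENNReal (EReal.neg_le_neg_iff.2 (ENNReal.log_le_log h))

lemma surprisal_mul_le {p q : ℝ≥0∞} (hp : p ≠ ∞) (hq : q ≠ ∞) :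
    surprisal (p * q) ≤ surprisal p + surprisal q := by
  rw [surprisal, ENNReal.log_mul_add, EReal.neg_add (.inr (by simpa)) (.inl (by simpa)),
    sub_eq_add_neg]
  exact EReal.toENNReal_add_le

lemma surprisal_pow_le {p : ℝ≥0∞} (hp : p ≠ ∞) (n : ℕ) : surprisal (p ^ n) ≤ n * surprisal p := by
  induction n with
  | zero => simp [surprisal_one]
  | succ n ih =>
    rw [pow_succ, Nat.cast_succ, add_one_mul]
    exact (surprisal_mul_le (ENNReal.pow_ne_top hp) hp).trans (by gcongr)

lemma exists_ofReal_eq_of_le_one {p : ℝ≥0∞} (h0 : p ≠ 0) (h1 : p ≤ 1) :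
    ∃ a : ℝ, 0 < a ∧ a ≤ 1 ∧ ENNReal.ofReal a = p := by
  have hp : p ≠ ∞ := ne_top_of_le_ne_top ENNReal.one_ne_top h1
  exact ⟨p.toReal, ENNReal.toReal_pos h0 hp, ENNReal.toReal_le_of_le_ofReal zero_le_one (by simpa),
    ENNReal.ofReal_toReal hp⟩

lemma mul_surprisal {p : ℝ≥0∞} (hp : p ≤ 1) :
    p * surprisal p = ENNReal.ofReal (Real.negMulLog p.toReal) := by
  rcases eq_or_ne p 0 with rfl | h0
  · simp
  obtain ⟨a, ha, -, rfl⟩ := exists_ofReal_eq_of_le_one h0 hp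
  rw [surprisal_ofReal ha, ← ENNReal.ofReal_mul ha.le, ENNReal.toReal_ofReal ha.le, Real.negMulLog,
    neg_mul_comm]

lemma mul_surprisal_add_le {p q : ℝ≥0∞} (hp : p ≤ 1) (hq : q ≤ 1) :
    p * surprisal p + p ≤ p * surprisal q + q := by
  rcases eq_or_ne p 0 with rfl | hp0
  · simp
  rcases eq_or_ne q 0 with rfl | hq0
  · simp [surprisal_zero, hp0]
  obtain ⟨a, ha, ha1, rfl⟩ := exists_ofReal_eq_of_le_one hp0 hp
  obtain ⟨b, hb, hb1, rfl⟩ := exists_ofReal_eq_of_le_one hq0 hq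
  have hla := Real.log_nonpos ha.le ha1
  have hlb := Real.log_nonpos hb.le hb1
  have hlog : a * (Real.log b - Real.log a) ≤ b - a := by
    calc a * (Real.log b - Real.log a) = a * Real.log (b / a) := by
          rw [Real.log_div hb.ne' ha.ne']
      _ ≤ a * (b / a - 1) := by gcongr; exact Real.log_le_sub_one_of_pos (by positivity)
      _ = b - a := by field_simp
  rw [surprisal_ofReal ha, surprisal_ofReal hb, ← ENNReal.ofReal_mul ha.le,
    ← ENNReal.ofReal_mul ha.le, ← ENNReal.ofReal_add (mul_nonneg ha.le (by linarith)) ha.le,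
    ← ENNReal.ofReal_add (mul_nonneg ha.le (by linarith)) hb.le]
  exact ENNReal.ofReal_le_ofReal (by linarith)

variable {α β : Type*}

lemma entropy_eq_tsum (P : PMF α) : entropy P = ∑' x, P x * surprisal (P x) :=
  tsum_congr fun x => (mul_surprisal (P.coe_le_one x)).symm

lemma entropy_le_tsum_mul_surprisal (P Q : PMF α) : entropy P ≤ ∑' x, P x * surprisal (Q x) := by
  refine (ENNReal.add_le_add_iff_right ENNReal.one_ne_top).1 ?_
  calc entropy P + 1 = ∑' x, (P x * surprisal (P x) + P x) := by
        rw [ENNReal.tsum_add, P.tsum_coe, entropy_eq_tsum]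
    _ ≤ ∑' x, (P x * surprisal (Q x) + Q x) :=
        ENNReal.tsum_le_tsum fun x => mul_surprisal_add_le (P.coe_le_one x) (Q.coe_le_one x)
    _ = ∑' x, P x * surprisal (Q x) + 1 := by rw [ENNReal.tsum_add, Q.tsum_coe]

lemma entropy_pure (x : α) : entropy (PMF.pure x) = 0 := by
  classical
  rw [entropy, ENNReal.tsum_eq_zero]
  intro y
  by_cases h : y = x <;> simp [PMF.pure_apply, h]

lemma entropy_map_le (P : PMF α) (φ : α → β) : entropy (P.map φ) ≤ entropy P := by
  rw [entropy_eq_tsum, entropy_eq_tsum, tsum_map_mul]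
  gcongr with x
  exact antitone_surprisal (apply_le_map_apply P φ x)

lemma entropy_map_of_leftInverse (P : PMF α) {φ : α → β} {ψ : β → α}
    (h : Function.LeftInverse ψ φ) : entropy (P.map φ) = entropy P := by
  refine (entropy_map_le P φ).antisymm ?_
  simpa only [PMF.map_comp, h.comp_eq_id, PMF.map_id] using entropy_map_le (P.map φ) ψ

lemma entropy_bind_le (P : PMF α) (Q : α → PMF β) :
    entropy (P.bind Q) ≤ entropy P + ∑' x, P x * entropy (Q x) := by
  calc entropy (P.bind Q) = ∑' x, P x * ∑' z, Q x z * surprisal (P.bind Q z) := by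
        rw [entropy_eq_tsum, tsum_bind_mul]
    _ ≤ ∑' x, P x * ∑' z, Q x z * (surprisal (P x) + surprisal (Q x z)) := by
        gcongr with x z
        exact (antitone_surprisal (mul_apply_le_bind_apply P Q x z)).trans
          (surprisal_mul_le (P.apply_ne_top x) ((Q x).apply_ne_top z))
    _ = entropy P + ∑' x, P x * entropy (Q x) := by
        simp only [mul_add, ENNReal.tsum_add, ENNReal.tsum_mul_right, PMF.tsum_coe, one_mul,
          entropy_eq_tsum]

lemma tsum_mul_entropy_le_entropy_bind (P : PMF α) (Q : α → PMF β) :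
    ∑' x, P x * entropy (Q x) ≤ entropy (P.bind Q) := by
  rw [entropy_eq_tsum (P.bind Q), tsum_bind_mul]
  gcongr with x
  exact entropy_le_tsum_mul_surprisal (Q x) (P.bind Q)

end Entropy

section Artanh

lemma artanh_sub_div_add {a b : ℝ} (ha : 0 < a) (hb : 0 < b) :
    Real.artanh ((a - b) / (a + b)) = 1 / 2 * (Real.log a - Real.log b) := by
  have hab : 0 < a + b := add_pos ha hb
  have hmem : (a - b) / (a + b) ∈ Set.Icc (-1) 1 := by
    rw [Set.mem_Icc, le_div_iff₀ hab, div_le_iff₀ hab]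
    constructor <;> linarith
  have hadd : 1 + (a - b) / (a + b) = 2 * a / (a + b) := by field_simp; ring
  have hsub : 1 - (a - b) / (a + b) = 2 * b / (a + b) := by field_simp; ring
  rw [Real.artanh_eq_half_log hmem, hadd, hsub, div_div_div_cancel_right₀ hab.ne',
    mul_div_mul_left _ _ two_ne_zero, Real.log_div ha.ne' hb.ne']

lemma two_div_two_mul_sub_one_nonneg (n : ℕ+) : 0 ≤ 2 / (2 * (n : ℝ) - 1) := by
  have : (1 : ℝ) ≤ (n : ℕ) := Nat.one_le_cast.2 n.pos
  exact div_nonneg zero_le_two (by linarith)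

lemma hasSum_two_mul_artanh {x : ℝ} (hx : |x| < 1) :
    HasSum (fun n : ℕ+ => 2 / (2 * (n : ℝ) - 1) * x ^ (2 * (n : ℕ))) (2 * x * Real.artanh x) := by
  obtain ⟨hx1, hx2⟩ := abs_lt.1 hx
  have hlog : 2 * x * Real.artanh x = x * (Real.log (1 + x) - Real.log (1 - x)) := by
    rw [Real.artanh_eq_half_log ⟨hx1.le, hx2.le⟩, Real.log_div (by linarith) (by linarith)]
    ring
  have hodd := (Real.hasSum_log_sub_log_of_abs_lt_one hx).mul_left x
  rw [← Equiv.pnatEquivNat.hasSum_iff, ← hlog] at hodd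
  refine hodd.congr_fun fun n => ?_
  obtain ⟨k, rfl⟩ := Equiv.pnatEquivNat.symm.surjective n
  simp only [Function.comp_apply, Equiv.pnatEquivNat_symm_apply, Equiv.pnatEquivNat_apply,
    Nat.natPred_succPNat, Nat.succPNat_coe, Nat.succ_eq_add_one]
  push_cast
  rw [show 2 * ((k : ℝ) + 1) - 1 = 2 * k + 1 by ring]
  ring

/-- The power series of `x ↦ 2 x artanh x`, with value in `[0, ∞]` for every `x` in `[0, ∞]`. -/
noncomputable def artanhSeries (x : ℝ≥0∞) : ℝ≥0∞ :=
  ∑' n : ℕ+, ENNReal.ofReal (2 / (2 * (n : ℝ) - 1)) * x ^ (2 * (n : ℕ))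

lemma artanhSeries_ofReal {x : ℝ} (hx0 : 0 ≤ x) (hx1 : x < 1) :
    artanhSeries (ENNReal.ofReal x) = ENNReal.ofReal (2 * x * Real.artanh x) := by
  have hsum := hasSum_two_mul_artanh (abs_lt.2 ⟨by linarith, hx1⟩)
  have hnonneg (n : ℕ+) := two_div_two_mul_sub_one_nonneg n
  rw [← hsum.tsum_eq, ENNReal.ofReal_tsum_of_nonneg
    (fun n => mul_nonneg (hnonneg n) (by positivity)) hsum.summable]
  exact tsum_congr fun n => by rw [ENNReal.ofReal_mul (hnonneg n), ENNReal.ofReal_pow hx0]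

/-- The relative difference `|p - q| / (p + q)`; one of the two truncated differences is `0`. -/
noncomputable def relDiff (p q : ℝ≥0∞) : ℝ≥0∞ := ((p - q) + (q - p)) / (p + q)

lemma relDiff_comm (p q : ℝ≥0∞) : relDiff p q = relDiff q p := by
  rw [relDiff, relDiff, add_comm (p - q), add_comm p]

lemma add_mul_relDiff {p q : ℝ≥0∞} (hp : p ≠ ∞) (hq : q ≠ ∞) :
    (p + q) * relDiff p q = (p - q) + (q - p) := by
  refine ENNReal.mul_div_cancel' (fun h => ?_) fun h => ?_
  · obtain ⟨rfl, rfl⟩ := add_eq_zero.1 h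
    simp
  · exact absurd h (ENNReal.add_ne_top.2 ⟨hp, hq⟩)

lemma add_mul_artanhSeries_relDiff_ofReal {a b : ℝ} (hb : 0 < b) (hba : b ≤ a) :
    (ENNReal.ofReal a + ENNReal.ofReal b) *
        artanhSeries (relDiff (ENNReal.ofReal a) (ENNReal.ofReal b)) =
      ENNReal.ofReal ((a - b) * (Real.log a - Real.log b)) := by
  have ha : 0 < a := hb.trans_le hba
  have hab : 0 < a + b := add_pos ha hb
  have hrel : relDiff (ENNReal.ofReal a) (ENNReal.ofReal b) =
      ENNReal.ofReal ((a - b) / (a + b)) := by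
    rw [relDiff, tsub_eq_zero_of_le (ENNReal.ofReal_le_ofReal hba), add_zero,
      ← ENNReal.ofReal_sub _ hb.le, ← ENNReal.ofReal_add ha.le hb.le,
      ← ENNReal.ofReal_div_of_pos hab]
  rw [hrel, artanhSeries_ofReal (div_nonneg (sub_nonneg.2 hba) hab.le)
      ((div_lt_one hab).2 (by linarith)), artanh_sub_div_add ha hb,
    ← ENNReal.ofReal_add ha.le hb.le, ← ENNReal.ofReal_mul hab.le]
  congr 1
  field_simp

-- For `p, q > 0` this is the identity `(p - q) (log p - log q) = (p + q) · 2 r artanh r` with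
-- `r = |p - q| / (p + q)`.
lemma add_mul_artanhSeries_relDiff_add_le {p q : ℝ≥0∞} (hp : p ≤ 1) (hq : q ≤ 1) :
    (p + q) * artanhSeries (relDiff p q) + (p * surprisal p + q * surprisal q) ≤
      p * surprisal q + q * surprisal p := by
  wlog hqp : q ≤ p generalizing p q
  · have := this hq hp (le_of_not_ge hqp)
    rwa [relDiff_comm, add_comm q p, add_comm (q * _), add_comm (q * _)] at this
  rcases eq_or_ne p 0 with rfl | hp0
  · simp [nonpos_iff_eq_zero.1 hqp]
  rcases eq_or_ne q 0 with rfl | hq0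
  · simp [surprisal_zero, hp0]
  obtain ⟨a, ha, ha1, rfl⟩ := exists_ofReal_eq_of_le_one hp0 hp
  obtain ⟨b, hb, hb1, rfl⟩ := exists_ofReal_eq_of_le_one hq0 hq
  have hba : b ≤ a := (ENNReal.ofReal_le_ofReal_iff ha.le).1 hqp
  have hla : 0 ≤ -Real.log a := neg_nonneg.2 (Real.log_nonpos ha.le ha1)
  have hlb : 0 ≤ -Real.log b := neg_nonneg.2 (Real.log_nonpos hb.le hb1)
  have hdiff : 0 ≤ (a - b) * (Real.log a - Real.log b) :=
    mul_nonneg (sub_nonneg.2 hba) (sub_nonneg.2 (Real.log_le_log hb hba))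
  rw [add_mul_artanhSeries_relDiff_ofReal hb hba, surprisal_ofReal ha, surprisal_ofReal hb,
    ← ENNReal.ofReal_mul ha.le, ← ENNReal.ofReal_mul ha.le, ← ENNReal.ofReal_mul hb.le,
    ← ENNReal.ofReal_mul hb.le, ← ENNReal.ofReal_add (by positivity) (by positivity),
    ← ENNReal.ofReal_add hdiff (by positivity),
    ← ENNReal.ofReal_add (by positivity) (by positivity)]
  exact ENNReal.ofReal_le_ofReal (by linarith)

end Artanh

section Convolution

variable {Γ : Type*} [Group Γ]

/-- The multiplicative convolution: the law of `x * y` for independent `x` and `y` with laws `P`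
and `Q`. -/
noncomputable def mconv (P Q : PMF Γ) : PMF Γ := P.bind fun x => Q.map fun y => x * y

lemma mconv_assoc (P Q R : PMF Γ) : mconv (mconv P Q) R = mconv P (mconv Q R) := by
  simp only [mconv, PMF.bind_bind, PMF.map_bind, PMF.bind_map, PMF.map_comp, Function.comp_def,
    mul_assoc]

lemma mconv_pure_one (P : PMF Γ) : mconv P (PMF.pure 1) = P := by
  simp [mconv, PMF.pure_map]

lemma bind_mconv {α : Type*} (P : PMF α) (Q : α → PMF Γ) (R : PMF Γ) :
    mconv (P.bind Q) R = P.bind fun x => mconv (Q x) R :=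
  PMF.bind_bind P Q _

lemma convPow_succ (μ : PMF Γ) (n : ℕ) : convPow μ (n + 1) = mconv (convPow μ n) μ := rfl

lemma convPow_one (μ : PMF Γ) : convPow μ 1 = μ := by
  simp only [convPow, PMF.pure_bind, one_mul]
  exact PMF.map_id μ

lemma convPow_add (μ : PMF Γ) (m n : ℕ) :
    convPow μ (m + n) = mconv (convPow μ m) (convPow μ n) := by
  induction n with
  | zero => exact (mconv_pure_one _).symm
  | succ n ih => rw [← add_assoc, convPow_succ, convPow_succ, ih, mconv_assoc]

lemma entropy_mconv_le (P Q : PMF Γ) : entropy (mconv P Q) ≤ entropy P + entropy Q := by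
  calc entropy (mconv P Q) ≤ entropy P + ∑' x, P x * entropy (Q.map fun y => x * y) :=
        entropy_bind_le _ _
    _ ≤ entropy P + ∑' x, P x * entropy Q := by gcongr; exact entropy_map_le _ _
    _ = entropy P + entropy Q := by rw [ENNReal.tsum_mul_right, P.tsum_coe, one_mul]

lemma entropy_le_entropy_mconv (P Q : PMF Γ) : entropy Q ≤ entropy (mconv P Q) := by
  calc entropy Q = ∑' x, P x * entropy (Q.map fun y => x * y) := by
        simp only [entropy_map_of_leftInverse Q (inv_mul_cancel_left _), ENNReal.tsum_mul_right,
          P.tsum_coe, one_mul]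
    _ ≤ entropy (mconv P Q) := tsum_mul_entropy_le_entropy_bind _ _

end Convolution

section EdgeSum

variable {Γ : Type*} [Group Γ] {μ : PMF Γ}

/-- The total weight of `F` over the edges `(x, x g)` of the walk on `Γ` with step law `μ`, where
the starting point `x` carries the counting measure. -/
noncomputable def edgeSum (μ : PMF Γ) (F : Γ → Γ → ℝ≥0∞) : ℝ≥0∞ :=
  ∑' x, ∑' g, μ g * F x (x * g)

lemma edgeSum_eq_tsum_prod (F : Γ → Γ → ℝ≥0∞) :
    edgeSum μ F = ∑' e : Γ × Γ, μ e.2 * F e.1 (e.1 * e.2) := by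
  rw [edgeSum, ENNReal.tsum_prod']

lemma edgeSum_add (F F' : Γ → Γ → ℝ≥0∞) :
    edgeSum μ (fun x y => F x y + F' x y) = edgeSum μ F + edgeSum μ F' := by
  simp only [edgeSum, mul_add, ENNReal.tsum_add]

lemma edgeSum_left (f : Γ → ℝ≥0∞) : edgeSum μ (fun x _ => f x) = ∑' x, f x := by
  simp only [edgeSum, ENNReal.tsum_mul_right, μ.tsum_coe, one_mul]

-- The counting measure is reversible for right multiplication by symmetric increments.
lemma edgeSum_swap (hsymm : ∀ g, μ g⁻¹ = μ g) (F : Γ → Γ → ℝ≥0∞) :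
    edgeSum μ (fun x y => F y x) = edgeSum μ F := by
  rw [edgeSum, edgeSum, ENNReal.tsum_comm, ENNReal.tsum_comm (f := fun x g => μ g * F x (x * g)),
    ← (Equiv.inv Γ).tsum_eq]
  refine tsum_congr fun g => ?_
  rw [← (Equiv.mulRight g).tsum_eq]
  simp [hsymm]

lemma edgeSum_le_of_add_swap_le (hsymm : ∀ g, μ g⁻¹ = μ g) {F F' : Γ → Γ → ℝ≥0∞}
    (h : ∀ x y, F x y + F y x ≤ F' x y + F' y x) : edgeSum μ F ≤ edgeSum μ F' := by
  refine (ENNReal.mul_le_mul_iff_right two_ne_zero ENNReal.ofNat_ne_top).1 ?_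
  have two_mul_edgeSum (F : Γ → Γ → ℝ≥0∞) :
      2 * edgeSum μ F = edgeSum μ fun x y => F x y + F y x := by
    rw [edgeSum_add, edgeSum_swap hsymm, two_mul]
  rw [two_mul_edgeSum, two_mul_edgeSum]
  exact ENNReal.tsum_le_tsum fun x => ENNReal.tsum_le_tsum fun g => by gcongr; exact h _ _

lemma tsum_mconv_mul (P Q : PMF Γ) (f : Γ → ℝ≥0∞) :
    ∑' z, mconv P Q z * f z = edgeSum Q fun x y => P x * f y := by
  simp only [mconv, tsum_bind_mul, tsum_map_mul, edgeSum, ← ENNReal.tsum_mul_left, mul_left_comm]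

lemma edgeSum_mul_artanhSeries (G : Γ → ℝ≥0∞) (f : Γ → Γ → ℝ≥0∞) :
    edgeSum μ (fun x y => G x * artanhSeries (f x y)) =
      ∑' n : ℕ+, ENNReal.ofReal (2 / (2 * (n : ℝ) - 1)) *
        edgeSum μ fun x y => G x * f x y ^ (2 * (n : ℕ)) := by
  simp only [edgeSum, artanhSeries, ← ENNReal.tsum_mul_left]
  conv_rhs => rw [ENNReal.tsum_comm]
  refine tsum_congr fun x => ?_
  conv_rhs => rw [ENNReal.tsum_comm]
  exact tsum_congr fun g => tsum_congr fun n => by ring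

lemma edgeSum_artanhSeries_relDiff_add_entropy_le (hsymm : ∀ g, μ g⁻¹ = μ g) (G : PMF Γ) :
    edgeSum μ (fun x y => G x * artanhSeries (relDiff (G x) (G y))) + entropy G ≤
      ∑' y, mconv G μ y * surprisal (G y) := by
  rw [entropy_eq_tsum, ← edgeSum_left (μ := μ), ← edgeSum_add, tsum_mconv_mul]
  refine edgeSum_le_of_add_swap_le hsymm fun x y => ?_
  calc _ = (G x + G y) * artanhSeries (relDiff (G x) (G y)) +
          (G x * surprisal (G x) + G y * surprisal (G y)) := by
        rw [relDiff_comm (G y)]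
        ring
    _ ≤ _ := add_mul_artanhSeries_relDiff_add_le (G.coe_le_one x) (G.coe_le_one y)

end EdgeSum

section Length

lemma mul_edist_add_mul_edist_le {X : Type*} [PseudoEMetricSpace X] {p q : ℝ≥0∞} (hp : p ≠ ∞)
    (hq : q ≠ ∞) (x y z : X) :
    p * edist y z + q * edist x z ≤
      p * edist x z + q * edist y z + (p + q) * relDiff p q * edist x y := by
  rw [add_mul_relDiff hp hq]
  wlog hqp : q ≤ p generalizing p q x y
  · have := this hq hp y x (le_of_not_ge hqp)
    rwa [add_comm (q * _), add_comm (q * _), add_comm (q - p), edist_comm y x] at this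
  rw [tsub_eq_zero_of_le hqp, add_zero]
  calc p * edist y z + q * edist x z
      = q * edist y z + (p - q) * edist y z + q * edist x z := by
        rw [← add_mul, add_tsub_cancel_of_le hqp]
    _ ≤ q * edist y z + (p - q) * (edist x y + edist x z) + q * edist x z := by
        gcongr
        rw [edist_comm x y]
        exact edist_triangle _ _ _
    _ = (q + (p - q)) * edist x z + q * edist y z + (p - q) * edist x y := by ring
    _ = _ := by rw [add_tsub_cancel_of_le hqp]

variable {Γ : Type*} [Group Γ] [MetricSpace Γ]

lemma meanLength_eq_tsum (ν : PMF Γ) : meanLength ν = ∑' g, ν g * edist g 1 := by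
  simp only [meanLength, edist_dist, mul_comm]

lemma pMoment_eq_tsum {p : ℝ} (hp : 0 ≤ p) (ν : PMF Γ) :
    pMoment p ν = (∑' g, ν g * edist g 1 ^ p) ^ (1 / p) := by
  simp only [pMoment, edist_dist, ENNReal.ofReal_rpow_of_nonneg dist_nonneg hp, mul_comm]

lemma meanLength_pure_one : meanLength (PMF.pure (1 : Γ)) = 0 := by
  classical
  rw [meanLength_eq_tsum, ENNReal.tsum_eq_zero]
  intro g
  by_cases h : g = 1 <;> simp [PMF.pure_apply, h]

lemma meanLength_bind {α : Type*} (P : PMF α) (Q : α → PMF Γ) :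
    meanLength (P.bind Q) = ∑' x, P x * meanLength (Q x) := by
  simp only [meanLength_eq_tsum, tsum_bind_mul]

lemma meanLength_mconv (P Q : PMF Γ) :
    meanLength (mconv P Q) = edgeSum Q fun x y => P x * edist y 1 := by
  rw [meanLength_eq_tsum, tsum_mconv_mul]

lemma meanLength_mconv_le_add_edgeSum {μ : PMF Γ} (hsymm : ∀ g, μ g⁻¹ = μ g) (G : PMF Γ) :
    meanLength (mconv G μ) ≤
      meanLength G + edgeSum μ fun x y => G x * (relDiff (G x) (G y) * edist x y) := by
  rw [meanLength_mconv, meanLength_eq_tsum, ← edgeSum_left (μ := μ), ← edgeSum_add]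
  refine edgeSum_le_of_add_swap_le hsymm fun x y => ?_
  refine (mul_edist_add_mul_edist_le (G.apply_ne_top x) (G.apply_ne_top y) x y 1).trans_eq ?_
  rw [relDiff_comm (G y), edist_comm y x]
  ring

variable [IsIsometricSMul Γ Γ]

lemma edist_self_mul (x g : Γ) : edist x (x * g) = edist g 1 := by
  simpa [edist_comm] using edist_mul_left x 1 g

lemma meanLength_add_meanLength (P Q : PMF Γ) :
    meanLength P + meanLength Q = edgeSum Q fun x y => P x * (edist x y + edist x 1) := by
  rw [add_comm]
  simp only [mul_add, edgeSum_add, edgeSum_left]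
  simp only [edgeSum, edist_self_mul, mul_left_comm (Q _), ENNReal.tsum_mul_left,
    ENNReal.tsum_mul_right, P.tsum_coe, one_mul, meanLength_eq_tsum]

lemma meanLength_mconv_le (P Q : PMF Γ) :
    meanLength (mconv P Q) ≤ meanLength P + meanLength Q := by
  rw [meanLength_mconv, meanLength_add_meanLength, edgeSum, edgeSum]
  gcongr with x g
  exact edist_triangle_left _ _ _

lemma meanLength_mconv_lt {P Q : PMF Γ} (h : meanLength (mconv P Q) ≠ ∞) {g : Γ} (hg : g ≠ 1)
    (hP : P g ≠ 0) (hQ : Q g⁻¹ ≠ 0) : meanLength (mconv P Q) < meanLength P + meanLength Q := by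
  rw [meanLength_mconv, edgeSum_eq_tsum_prod] at h ⊢
  rw [meanLength_add_meanLength, edgeSum_eq_tsum_prod]
  refine ENNReal.tsum_lt_tsum (i := (g, g⁻¹)) h (fun e => ?_) ?_
  · gcongr
    exact edist_triangle_left _ _ _
  · simp [pos_iff_ne_zero, hg, hP, hQ]

lemma edgeSum_mul_edist_le {r q : ℝ} (hrq : r.HolderConjugate q) (G μ : PMF Γ)
    (f : Γ → Γ → ℝ≥0∞) :
    edgeSum μ (fun x y => G x * (f x y * edist x y)) ≤
      (edgeSum μ fun x y => G x * f x y ^ r) ^ (1 / r) * pMoment q μ := by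
  have hmoment : pMoment q μ = (edgeSum μ fun x y => G x * edist x y ^ q) ^ (1 / q) := by
    simp only [pMoment_eq_tsum hrq.symm.nonneg, edgeSum, edist_self_mul, mul_left_comm (μ _),
      ENNReal.tsum_mul_left, ENNReal.tsum_mul_right, G.tsum_coe, one_mul]
  simp only [hmoment, edgeSum_eq_tsum_prod, ← mul_assoc (μ _)]
  exact tsum_mul_mul_le_rpow_mul_rpow hrq _ _ _

lemma div_pMoment_pow_le_edgeSum {ℓ : ℝ≥0∞} {G μ : PMF Γ} {f : Γ → Γ → ℝ≥0∞}
    (hℓ : ℓ ≤ edgeSum μ fun x y => G x * (f x y * edist x y)) (n : ℕ+) :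
    (ℓ / pMoment (1 + 1 / (2 * (n : ℝ) - 1)) μ) ^ (2 * (n : ℕ)) ≤
      edgeSum μ fun x y => G x * f x y ^ (2 * (n : ℕ)) := by
  have hn : (1 : ℝ) ≤ (n : ℕ) := Nat.one_le_cast.2 n.pos
  have hconj : (2 * (n : ℝ)).HolderConjugate (1 + 1 / (2 * (n : ℝ) - 1)) := by
    have hne : 2 * (n : ℝ) - 1 ≠ 0 := by linarith
    convert Real.HolderConjugate.conjExponent (show 1 < 2 * (n : ℝ) by linarith) using 1
    rw [Real.conjExponent]
    field_simp
    ring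
  have hle := hℓ.trans (edgeSum_mul_edist_le hconj G μ f)
  have hexp : 2 * (n : ℝ) = (2 * (n : ℕ) : ℕ) := by push_cast; rfl
  calc (ℓ / pMoment (1 + 1 / (2 * (n : ℝ) - 1)) μ) ^ (2 * (n : ℕ))
      ≤ ((edgeSum μ fun x y => G x * f x y ^ (2 * (n : ℝ))) ^ (1 / (2 * (n : ℝ)))) ^
          (2 * (n : ℕ)) := by
        gcongr
        exact ENNReal.div_le_of_le_mul hle
    _ = edgeSum μ fun x y => G x * f x y ^ (2 * (n : ℕ)) := by
        rw [← ENNReal.rpow_natCast, ← hexp, ← ENNReal.rpow_mul, one_div_mul_cancel (by linarith),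
          ENNReal.rpow_one]
        simp only [hexp, ENNReal.rpow_natCast]

lemma driftSeries_le_edgeSum {G μ : PMF Γ} {f : Γ → Γ → ℝ≥0∞}
    (hdrift : drift μ ≤ edgeSum μ fun x y => G x * (f x y * edist x y)) :
    driftSeries μ ≤ edgeSum μ fun x y => G x * artanhSeries (f x y) := by
  rw [edgeSum_mul_artanhSeries, driftSeries]
  gcongr with n
  exact div_pMoment_pow_le_edgeSum hdrift n

end Length

section Limits

variable {Γ : Type*} [Group Γ]

lemma entropy_convPow_add_le (μ : PMF Γ) (m n : ℕ) :
    entropy (convPow μ (m + n)) ≤ entropy (convPow μ m) + entropy (convPow μ n) := by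
  rw [convPow_add]
  exact entropy_mconv_le _ _

lemma entropy_convPow_ne_top {μ : PMF Γ} (h : entropy μ ≠ ∞) (n : ℕ) :
    entropy (convPow μ n) ≠ ∞ := by
  have hle := le_nat_mul_of_subadditive (u := fun n => entropy (convPow μ n)) (entropy_pure 1)
    (entropy_convPow_add_le μ) n
  rw [convPow_one] at hle
  exact ne_top_of_le_ne_top (ENNReal.mul_ne_top (ENNReal.natCast_ne_top n) h) hle

lemma tendsto_entropy_convPow_div_of_eq_top {μ : PMF Γ} (h : entropy μ = ∞) :
    Tendsto (fun n : ℕ => entropy (convPow μ n) / (n : ℝ≥0∞)) atTop (𝓝 ∞) := by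
  refine tendsto_const_nhds.congr' ?_
  filter_upwards [eventually_gt_atTop 0] with n hn
  obtain ⟨m, rfl⟩ := Nat.exists_eq_add_of_lt hn
  have htop : entropy (mconv (convPow μ m) μ) = ∞ :=
    top_le_iff.1 (h.ge.trans (entropy_le_entropy_mconv _ _))
  rw [zero_add, convPow_succ, htop, ENNReal.top_div_of_ne_top (ENNReal.natCast_ne_top _)]

lemma tendsto_asympEntropy (μ : PMF Γ) :
    Tendsto (fun n : ℕ => entropy (convPow μ n) / (n : ℝ≥0∞)) atTop (𝓝 (asympEntropy μ)) := by
  refine tendsto_nhds_limUnder ?_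
  by_cases h : entropy μ = ∞
  · exact ⟨∞, tendsto_entropy_convPow_div_of_eq_top h⟩
  · obtain ⟨l, -, hl, -⟩ := exists_tendsto_div_of_subadditive (entropy_convPow_add_le μ)
      (entropy_convPow_ne_top h)
    exact ⟨l, hl⟩

variable [MetricSpace Γ] [IsIsometricSMul Γ Γ]

lemma meanLength_convPow_add_le (μ : PMF Γ) (m n : ℕ) :
    meanLength (convPow μ (m + n)) ≤ meanLength (convPow μ m) + meanLength (convPow μ n) := by
  rw [convPow_add]
  exact meanLength_mconv_le _ _

lemma meanLength_convPow_le (μ : PMF Γ) (n : ℕ) :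
    meanLength (convPow μ n) ≤ n * meanLength μ := by
  simpa only [convPow_one] using le_nat_mul_of_subadditive
    (u := fun n => meanLength (convPow μ n)) meanLength_pure_one (meanLength_convPow_add_le μ) n

lemma meanLength_convPow_ne_top {μ : PMF Γ} (h : meanLength μ ≠ ∞) (n : ℕ) :
    meanLength (convPow μ n) ≠ ∞ :=
  ne_top_of_le_ne_top (ENNReal.mul_ne_top (ENNReal.natCast_ne_top n) h) (meanLength_convPow_le μ n)

lemma drift_spec {μ : PMF Γ} (h : meanLength μ ≠ ∞) : drift μ ≠ ∞ ∧
    Tendsto (fun n : ℕ => meanLength (convPow μ n) / (n : ℝ≥0∞)) atTop (𝓝 (drift μ)) ∧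
    ∀ n : ℕ, n * drift μ ≤ meanLength (convPow μ n) := by
  obtain ⟨l, hl, hlim, hle⟩ := exists_tendsto_div_of_subadditive (meanLength_convPow_add_le μ)
    (meanLength_convPow_ne_top h)
  rw [show drift μ = l from hlim.limUnder_eq]
  exact ⟨hl, hlim, hle⟩

end Limits

section GeometricLaw

open unitInterval

/-- The law on `ℕ` with weights `(1 - p) ^ n * p`: the number of steps of a walk that is killed with
probability `p` before each step. -/
noncomputable def geometricLaw (p : I) : PMF ℕ := (ProbabilityTheory.geometricMeasure p).toPMF

variable {p : I}

lemma geometricLaw_apply (hp : p ≠ 0) (n : ℕ) :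
    geometricLaw p n = ENNReal.ofReal (1 - p) ^ n * ENNReal.ofReal p := by
  rw [geometricLaw, MeasureTheory.Measure.toPMF_apply,
    ProbabilityTheory.geometricMeasure_singleton hp, ENNReal.ofReal_mul
    (pow_nonneg (one_minus_nonneg p) n), ENNReal.ofReal_pow (one_minus_nonneg p)]

lemma geometricLaw_succ (hp : p ≠ 0) (n : ℕ) :
    geometricLaw p (n + 1) = ENNReal.ofReal (1 - p) * geometricLaw p n := by
  rw [geometricLaw_apply hp, geometricLaw_apply hp, pow_succ']
  ring

lemma ofReal_one_sub_add_ofReal (p : I) :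
    ENNReal.ofReal (1 - p) + ENNReal.ofReal p = 1 := by
  rw [← ENNReal.ofReal_add (one_minus_nonneg p) (nonneg p), sub_add_cancel, ENNReal.ofReal_one]

lemma mul_tsum_geometricLaw_mul_natCast (hp : p ≠ 0) :
    ENNReal.ofReal p * ∑' n : ℕ, geometricLaw p n * n = ENNReal.ofReal (1 - p) := by
  have hp0 : 0 < (p : ℝ) := unitInterval.pos_iff_ne_zero.2 hp
  have hq0 := one_minus_nonneg p
  have hsum := (hasSum_coe_mul_geometric_of_norm_lt_one (r := (1 - p : ℝ)) (by
    rw [Real.norm_of_nonneg hq0]; linarith)).mul_left ((p : ℝ) ^ 2)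
  rw [sub_sub_cancel, mul_div_cancel₀ _ (by positivity)] at hsum
  rw [← hsum.tsum_eq, ENNReal.ofReal_tsum_of_nonneg (fun n => by positivity) hsum.summable,
    ← ENNReal.tsum_mul_left]
  refine tsum_congr fun n => ?_
  rw [geometricLaw_apply hp, ENNReal.ofReal_mul (by positivity), ENNReal.ofReal_pow hp0.le,
    ENNReal.ofReal_mul n.cast_nonneg, ENNReal.ofReal_natCast, ENNReal.ofReal_pow hq0]
  ring

lemma mul_tsum_geometricLaw_mul_affine (hp : p ≠ 0) (a b : ℝ≥0∞) :
    ENNReal.ofReal p * ∑' n : ℕ, geometricLaw p n * (n * a + b) =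
      ENNReal.ofReal (1 - p) * a + ENNReal.ofReal p * b := by
  simp only [mul_add, ENNReal.tsum_add, ← mul_assoc, ENNReal.tsum_mul_right, PMF.tsum_coe, one_mul,
    mul_tsum_geometricLaw_mul_natCast hp]

lemma mul_entropy_geometricLaw_le (hp : p ≠ 0) :
    ENNReal.ofReal p * entropy (geometricLaw p) ≤ ENNReal.ofReal (Real.binEntropy p) := by
  have hq0 := one_minus_nonneg p
  have hsurprisal (n : ℕ) : surprisal (geometricLaw p n) ≤
      n * surprisal (ENNReal.ofReal (1 - p)) + surprisal (ENNReal.ofReal p) := by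
    rw [geometricLaw_apply hp]
    refine (surprisal_mul_le (by finiteness) (by finiteness)).trans ?_
    gcongr
    exact surprisal_pow_le (by finiteness) n
  calc ENNReal.ofReal p * entropy (geometricLaw p)
      ≤ ENNReal.ofReal (1 - p) * surprisal (ENNReal.ofReal (1 - p)) +
          ENNReal.ofReal p * surprisal (ENNReal.ofReal p) := by
        rw [entropy_eq_tsum, ← mul_tsum_geometricLaw_mul_affine hp]
        gcongr with n
        exact hsurprisal n
    _ = ENNReal.ofReal (Real.binEntropy p) := by
        rw [mul_surprisal (ENNReal.ofReal_le_one.2 (one_minus_le_one p)),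
          mul_surprisal (ENNReal.ofReal_le_one.2 (le_one p)), ENNReal.toReal_ofReal hq0,
          ENNReal.toReal_ofReal (nonneg p), ← ENNReal.ofReal_add
            (Real.negMulLog_nonneg hq0 (one_minus_le_one p))
            (Real.negMulLog_nonneg (nonneg p) (le_one p)),
          Real.binEntropy_eq_negMulLog_add_negMulLog_one_sub, add_comm]

end GeometricLaw

section GeometricWalk

open unitInterval

variable {Γ : Type*} [Group Γ] {p : I}

/-- The law of the random walk with step law `μ` at an independent geometric time. -/
noncomputable def geometricWalk (p : I) (μ : PMF Γ) : PMF Γ :=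
  (geometricLaw p).bind (convPow μ)

lemma mconv_geometricWalk (p : I) (μ : PMF Γ) :
    mconv (geometricWalk p μ) μ = (geometricLaw p).bind fun n => convPow μ (n + 1) :=
  bind_mconv _ _ _

lemma mul_mconv_geometricWalk_apply_le (hp : p ≠ 0) (μ : PMF Γ) (y : Γ) :
    ENNReal.ofReal (1 - p) * mconv (geometricWalk p μ) μ y ≤ geometricWalk p μ y := by
  rw [mconv_geometricWalk, geometricWalk, PMF.bind_apply, PMF.bind_apply,
    tsum_eq_zero_add' (f := fun n => geometricLaw p n * convPow μ n y) ENNReal.summable,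
    ← ENNReal.tsum_mul_left]
  refine le_add_left (ENNReal.tsum_le_tsum fun n => ?_)
  rw [geometricLaw_succ hp, mul_assoc]

lemma mul_entropy_geometricWalk_le (hp : p ≠ 0) {μ : PMF Γ} {K C : ℝ≥0∞}
    (h : ∀ n : ℕ, entropy (convPow μ n) ≤ n * K + C) :
    ENNReal.ofReal p * entropy (geometricWalk p μ) ≤
      ENNReal.ofReal (Real.binEntropy p) + (ENNReal.ofReal (1 - p) * K + ENNReal.ofReal p * C) := by
  calc ENNReal.ofReal p * entropy (geometricWalk p μ)
      ≤ ENNReal.ofReal p * (entropy (geometricLaw p) +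
          ∑' n : ℕ, geometricLaw p n * (n * K + C)) := by
        gcongr
        refine (entropy_bind_le _ _).trans ?_
        gcongr with n
        exact h n
    _ ≤ _ := by
        rw [mul_add, mul_tsum_geometricLaw_mul_affine hp]
        gcongr
        exact mul_entropy_geometricLaw_le hp

lemma mul_edgeSum_artanhSeries_geometricWalk_le (hp : p ≠ 0) {μ : PMF Γ}
    (hsymm : ∀ g, μ g⁻¹ = μ g) :
    ENNReal.ofReal (1 - p) * edgeSum μ (fun x y => geometricWalk p μ x *
        artanhSeries (relDiff (geometricWalk p μ x) (geometricWalk p μ y))) ≤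
      ENNReal.ofReal p * entropy (geometricWalk p μ) := by
  set G := geometricWalk p μ
  by_cases hG : entropy G = ∞
  · have : ENNReal.ofReal p ≠ 0 := by simpa using pos_iff_ne_zero.2 hp
    simp [hG, this]
  refine (ENNReal.add_le_add_iff_right
    (ENNReal.mul_ne_top (ENNReal.ofReal_ne_top (r := 1 - p)) hG)).1 ?_
  calc _ ≤ ENNReal.ofReal (1 - p) * ∑' y, mconv G μ y * surprisal (G y) := by
        rw [← mul_add]
        gcongr
        exact edgeSum_artanhSeries_relDiff_add_entropy_le hsymm G
    _ ≤ entropy G := by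
        rw [entropy_eq_tsum, ← ENNReal.tsum_mul_left]
        simp only [← mul_assoc]
        gcongr with y
        exact mul_mconv_geometricWalk_apply_le hp μ y
    _ = _ := by rw [← add_mul, add_comm, ofReal_one_sub_add_ofReal, one_mul]

variable [MetricSpace Γ]

lemma meanLength_geometricWalk (hp : p ≠ 0) (μ : PMF Γ) :
    meanLength (geometricWalk p μ) =
      ENNReal.ofReal (1 - p) * meanLength (mconv (geometricWalk p μ) μ) := by
  rw [mconv_geometricWalk, geometricWalk, meanLength_bind, meanLength_bind,
    tsum_eq_zero_add' ENNReal.summable, convPow, meanLength_pure_one, mul_zero, zero_add,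
    ← ENNReal.tsum_mul_left]
  simp only [geometricLaw_succ hp, mul_assoc]

variable [IsIsometricSMul Γ Γ]

lemma meanLength_geometricWalk_ne_top (hp : p ≠ 0) {μ : PMF Γ} (h : meanLength μ ≠ ∞) :
    meanLength (geometricWalk p μ) ≠ ∞ := by
  have hp0 : ENNReal.ofReal p ≠ 0 := by simpa using pos_iff_ne_zero.2 hp
  have hle : ENNReal.ofReal p * meanLength (geometricWalk p μ) ≤
      ENNReal.ofReal (1 - p) * meanLength μ := by
    rw [geometricWalk, meanLength_bind]
    calc _ ≤ ENNReal.ofReal p * ∑' n : ℕ, geometricLaw p n * (n * meanLength μ + 0) := by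
          gcongr with n
          rw [add_zero]
          exact meanLength_convPow_le μ n
      _ = _ := by rw [mul_tsum_geometricLaw_mul_affine hp, mul_zero, add_zero]
  exact (ENNReal.lt_top_of_mul_ne_top_right (ne_top_of_le_ne_top (by finiteness) hle) hp0).ne

lemma drift_le_mul_meanLength_mconv_geometricWalk (hp : p ≠ 0) {μ : PMF Γ}
    (h : meanLength μ ≠ ∞) :
    drift μ ≤ ENNReal.ofReal p * meanLength (mconv (geometricWalk p μ) μ) := by
  calc drift μ = ENNReal.ofReal p * ∑' n : ℕ, geometricLaw p n * (n * drift μ + drift μ) := by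
        rw [mul_tsum_geometricLaw_mul_affine hp, ← add_mul, ofReal_one_sub_add_ofReal, one_mul]
    _ ≤ ENNReal.ofReal p * meanLength (mconv (geometricWalk p μ) μ) := by
        rw [mconv_geometricWalk, meanLength_bind]
        gcongr with n
        rw [← add_one_mul, ← Nat.cast_succ]
        exact (drift_spec h).2.2 (n + 1)

lemma drift_le_edgeSum_geometricWalk (hp : p ≠ 0) {μ : PMF Γ} (hsymm : ∀ g, μ g⁻¹ = μ g)
    (h : meanLength μ ≠ ∞) :
    drift μ ≤ edgeSum μ fun x y => geometricWalk p μ x *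
      (relDiff (geometricWalk p μ x) (geometricWalk p μ y) * edist x y) := by
  refine (drift_le_mul_meanLength_mconv_geometricWalk hp h).trans ?_
  refine (ENNReal.add_le_add_iff_left (meanLength_geometricWalk_ne_top hp h)).1 ?_
  calc _ = meanLength (mconv (geometricWalk p μ) μ) := by
        rw [meanLength_geometricWalk hp, ← add_mul, ofReal_one_sub_add_ofReal, one_mul]
    _ ≤ _ := meanLength_mconv_le_add_edgeSum hsymm _

lemma mul_driftSeries_le_mul_entropy_geometricWalk (hp : p ≠ 0) {μ : PMF Γ}
    (hsymm : ∀ g, μ g⁻¹ = μ g) (h : meanLength μ ≠ ∞) :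
    ENNReal.ofReal (1 - p) * driftSeries μ ≤ ENNReal.ofReal p * entropy (geometricWalk p μ) := by
  refine le_trans ?_ (mul_edgeSum_artanhSeries_geometricWalk_le hp hsymm)
  gcongr
  exact driftSeries_le_edgeSum (drift_le_edgeSum_geometricWalk hp hsymm h)

lemma driftSeries_le_of_entropy_convPow_le {μ : PMF Γ} (hsymm : ∀ g, μ g⁻¹ = μ g)
    (h : meanLength μ ≠ ∞) {K C : ℝ≥0∞} (hC : C ≠ ∞)
    (hent : ∀ n : ℕ, entropy (convPow μ n) ≤ n * K + C) : driftSeries μ ≤ K := by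
  have tendsto_ofReal {f : ℝ → ℝ} (hf : Continuous f) :
      Tendsto (fun p : I => ENNReal.ofReal (f p)) (𝓝[≠] 0) (𝓝 (ENNReal.ofReal (f 0))) :=
    ((ENNReal.continuous_ofReal.comp (hf.comp continuous_subtype_val)).tendsto 0).mono_left
      nhdsWithin_le_nhds
  have hone := tendsto_ofReal (continuous_sub_left 1)
  have hzero := tendsto_ofReal continuous_id
  have hbin := tendsto_ofReal Real.binEntropy_continuous
  simp only [id_eq, sub_zero, ENNReal.ofReal_one, ENNReal.ofReal_zero, Real.binEntropy_zero]
    at hone hzero hbin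
  have hleft := ENNReal.Tendsto.mul_const (b := driftSeries μ) hone (.inl one_ne_zero)
  have hright := hbin.add ((ENNReal.Tendsto.mul_const (b := K) hone (.inl one_ne_zero)).add
    (ENNReal.Tendsto.mul_const hzero (.inr hC)))
  rw [one_mul] at hleft
  rw [one_mul, zero_mul, add_zero, zero_add] at hright
  refine le_of_tendsto_of_tendsto hleft hright ?_
  filter_upwards [self_mem_nhdsWithin] with p hp
  exact (mul_driftSeries_le_mul_entropy_geometricWalk hp hsymm h).trans
    (mul_entropy_geometricWalk_le hp hent)

theorem driftSeries_le_asympEntropy {μ : PMF Γ} (hsymm : ∀ g, μ g⁻¹ = μ g)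
    (h : meanLength μ ≠ ∞) : driftSeries μ ≤ asympEntropy μ := by
  by_cases hent : entropy μ = ∞
  · rw [tendsto_nhds_unique (tendsto_asympEntropy μ) (tendsto_entropy_convPow_div_of_eq_top hent)]
    exact le_top
  refine le_of_forall_gt_imp_ge_of_dense fun K hK => ?_
  obtain ⟨C, hC, hle⟩ := exists_le_nat_mul_add_of_tendsto_div (entropy_convPow_ne_top hent)
    (tendsto_asympEntropy μ) hK
  exact driftSeries_le_of_entropy_convPow_le hsymm h hC hle

end GeometricWalk

section SecondMoment

variable {Γ : Type*} [Group Γ] [MetricSpace Γ]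

lemma pMoment_one (μ : PMF Γ) : pMoment 1 μ = meanLength μ := by
  simp only [pMoment, meanLength, Real.rpow_one, div_one, ENNReal.rpow_one]

lemma pMoment_mono {p q : ℝ} (hp : 0 < p) (hpq : p ≤ q) (μ : PMF Γ) :
    pMoment p μ ≤ pMoment q μ := by
  rw [pMoment_eq_tsum hp.le, pMoment_eq_tsum (hp.le.trans hpq)]
  exact rpow_mean_mono hp hpq μ _

lemma artanhSeries_drift_div_le_driftSeries (μ : PMF Γ) :
    artanhSeries (drift μ / pMoment 2 μ) ≤ driftSeries μ := by
  rw [artanhSeries, driftSeries]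
  gcongr with n
  have hn : (1 : ℝ) ≤ n := Nat.one_le_cast.2 n.pos
  have hpos : 0 < 2 * (n : ℝ) - 1 := by linarith
  have hle : 1 / (2 * (n : ℝ) - 1) ≤ 1 := (div_le_one₀ hpos).2 (by linarith)
  exact pMoment_mono (by positivity) (by linarith) μ

variable [IsIsometricSMul Γ Γ] {μ : PMF Γ}

lemma drift_lt_meanLength (hsymm : ∀ g, μ g⁻¹ = μ g) (h : meanLength μ ≠ ∞)
    (h0 : meanLength μ ≠ 0) : drift μ < meanLength μ := by
  have hsucc : convPow μ 2 = mconv μ μ := by rw [convPow_succ, convPow_one]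
  obtain ⟨g, hμg, hg⟩ : ∃ g, μ g ≠ 0 ∧ g ≠ 1 := by
    simpa [meanLength_eq_tsum] using h0
  refine lt_of_mul_lt_mul_left' (a := 2) ?_
  calc 2 * drift μ ≤ meanLength (mconv μ μ) := by
        rw [← hsucc]
        exact (drift_spec h).2.2 2
    _ < meanLength μ + meanLength μ :=
        meanLength_mconv_lt (hsucc ▸ meanLength_convPow_ne_top h 2) hg hμg ((hsymm g).trans_ne hμg)
    _ = 2 * meanLength μ := (two_mul _).symm

lemma drift_div_pMoment_two_lt_one (hsymm : ∀ g, μ g⁻¹ = μ g) (h : meanLength μ ≠ ∞) :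
    drift μ / pMoment 2 μ < 1 := by
  by_cases h0 : meanLength μ = 0
  · have hle := (drift_spec h).2.2 1
    rw [convPow_one, h0, Nat.cast_one, one_mul, nonpos_iff_eq_zero] at hle
    simp only [hle, ENNReal.zero_div, zero_lt_one]
  · refine ENNReal.div_lt_of_lt_mul ?_
    rw [one_mul]
    refine (drift_lt_meanLength hsymm h h0).trans_le ?_
    rw [← pMoment_one]
    exact pMoment_mono one_pos one_le_two μ

end SecondMoment

end GroupWalk

theorem mainTheorem4_general {Γ : Type*} [Group Γ] [MetricSpace Γ] [IsIsometricSMul Γ Γ]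
    (μ : PMF Γ) (hsymm : ∀ g : Γ, μ g⁻¹ = μ g) (hmoment : GroupWalk.meanLength μ ≠ ∞) :
    Tendsto (fun n : ℕ => GroupWalk.meanLength (GroupWalk.convPow μ n) / (n : ℝ≥0∞)) atTop
      (𝓝 (GroupWalk.drift μ)) ∧
    GroupWalk.drift μ ≠ ∞ ∧
    Tendsto (fun n : ℕ => GroupWalk.entropy (GroupWalk.convPow μ n) / (n : ℝ≥0∞)) atTop
      (𝓝 (GroupWalk.asympEntropy μ)) ∧
    GroupWalk.driftSeries μ ≤ GroupWalk.asympEntropy μ ∧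
    (GroupWalk.pMoment 2 μ ≠ ∞ →
      (GroupWalk.drift μ / GroupWalk.pMoment 2 μ).toReal < 1 ∧
      ENNReal.ofReal (2 * (GroupWalk.drift μ / GroupWalk.pMoment 2 μ).toReal *
          Real.artanh (GroupWalk.drift μ / GroupWalk.pMoment 2 μ).toReal) ≤
        GroupWalk.driftSeries μ) := by
  obtain ⟨hfin, hdrift, -⟩ := GroupWalk.drift_spec hmoment
  have hlt := GroupWalk.drift_div_pMoment_two_lt_one hsymm hmoment
  have htoReal : (GroupWalk.drift μ / GroupWalk.pMoment 2 μ).toReal < 1 :=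
    ENNReal.toReal_lt_of_lt_ofReal (by rwa [ENNReal.ofReal_one])
  refine ⟨hdrift, hfin, GroupWalk.tendsto_asympEntropy μ,
    GroupWalk.driftSeries_le_asympEntropy hsymm hmoment, fun _ => ⟨htoReal, ?_⟩⟩
  rw [← GroupWalk.artanhSeries_ofReal ENNReal.toReal_nonneg htoReal,
    ENNReal.ofReal_toReal hlt.ne_top]
  exact GroupWalk.artanhSeries_drift_div_le_driftSeries μ

theorem mainTheorem4 {Γ : Type*} [Group Γ] [Countable Γ] [MetricSpace Γ]
    (hleft : ∀ a x y : Γ, dist (a * x) (a * y) = dist x y)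
    (hproper : ∀ r : ℝ, (Metric.closedBall (1 : Γ) r).Finite)
    (μ : PMF Γ) (hsymm : ∀ g : Γ, μ g⁻¹ = μ g)
    (hmoment : GroupWalk.meanLength μ ≠ ∞) :
    -- the drift and the asymptotic entropy exist as limits, and the drift is finite
    Tendsto (fun n : ℕ => GroupWalk.meanLength (GroupWalk.convPow μ n) / (n : ℝ≥0∞)) atTop
      (𝓝 (GroupWalk.drift μ)) ∧
    GroupWalk.drift μ ≠ ∞ ∧
    Tendsto (fun n : ℕ => GroupWalk.entropy (GroupWalk.convPow μ n) / (n : ℝ≥0∞)) atTop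
      (𝓝 (GroupWalk.asympEntropy μ)) ∧
    -- the inequality
    GroupWalk.driftSeries μ ≤ GroupWalk.asympEntropy μ ∧
    -- for a finite second moment the left side dominates `2 x artanh x`, where `x = ℓ / M₂(μ)`
    (GroupWalk.pMoment 2 μ ≠ ∞ →
      (GroupWalk.drift μ / GroupWalk.pMoment 2 μ).toReal < 1 ∧
      ENNReal.ofReal (2 * (GroupWalk.drift μ / GroupWalk.pMoment 2 μ).toReal *
          Real.artanh (GroupWalk.drift μ / GroupWalk.pMoment 2 μ).toReal) ≤
        GroupWalk.driftSeries μ) := by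
  have : IsIsometricSMul Γ Γ := ⟨fun a => Isometry.of_dist_eq (hleft a)⟩
  exact mainTheorem4_general μ hsymm hmoment
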